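/- For a finite digraph $G$ (without loops or multiple arcs) and a real number $\alpha$ with $0\le\alpha<1$, let $A_\alpha(G)=\alpha D(G)+(1-\alpha)A(G)$, where $A(G)$ is the adjacency matrix and $D(G)$ the diagonal matrix of the outdegrees of $G$, and let the $\alpha$-spectral radius $\rho_\alpha(G)$ be the largest modulus of an eigenvalue of $A_\alpha(G)$. Digraphs are considered up to isomorphism. Let $k\ge 2$ and $m$ be natural numbers. For integers $p_1\ge\dots\ge p_k\ge 2$ with $p_1+\dots+p_k=m$, the rose digraph of $(p_1,\dots,p_k)$ consists of directed cycles of lengths $p_1,\dots,p_k$ that share exactly one common vertex and are otherwise disjoint. Let $\mathcal R_m^k$ be the set of all these digraphs. For $t\ge 1$ let $\widetilde S^t_n$ be the set of integer vectors $x_1\ge\dots\ge x_t\ge 1$ with $x_1+\dots+x_t=n$ and, if $t\ge 2$, $x_{t-1}\ge 2$. For $\mathbf K_1=(k_1,\dots,k_s)\in\widetilde S^s_{m_1}$ and $\mathbf K_2=(l_1,\dots,l_t)\in\widetilde S^t_{m_2}$, the generalized theta digraph $\widetilde\Theta(\mathbf K_1,\mathbf K_2)$ is formed from two distinct vertices $u,v$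 by adding directed paths of lengths $k_1,\dots,k_s$ from $u$ to $v$ and directed paths of lengths $l_1,\dots,l_t$ from $v$ to $u$, all of them internally disjoint. Let $\widetilde\Theta_k(m)$ be the set of all $\widetilde\Theta(\mathbf K_1,\mathbf K_2)$ with $s,t\ge1$, $s+t=k$ and $m_1+m_2=m$, and let $\widetilde\Theta^1_k(m)$ be the subset of those with $s=k-1$ and $t=1$. For $2k-2\le m$, write $\zeta_{k-1}=(2,\dots,2,1)$ (with $k-1$ entries) and $\widetilde\Theta_m(\zeta_{k-1})=\widetilde\Theta(\zeta_{k-1},(m-2k+3))$. Then, for every $\alpha\in[0,1)$: 1. If $m\ge 2k$, the rose digraph of $(m-2k+2,2,\dots,2)$ is the unique digraph (up to isomorphism) with maximal $\alpha$-spectral radius in $\mathcal R_m^k\cup\widetilde\Theta_k(m)$. 2. If $m\ge 2k-2$, the digraph $\widetilde\Theta_m(\zeta_{k-1})$ is the unique digraph (up to isomorphism) with minimal $\alpha$-spectral radius in $\mathcal R_m^k\cup\widetilde\Theta^1_k(m)$. -/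

import Mathlib

namespace AlphaSpectral

open Classical in
/-- The adjacency matrix of a digraph, with real entries. -/
noncomputable def adjMatrix {V : Type*} (G : Digraph V) : Matrix V V ℝ :=
  Matrix.of fun i j => if G.Adj i j then 1 else 0

/-- The outdegree of a vertex. -/
noncomputable def outdegree {V : Type*} (G : Digraph V) (v : V) : ℕ :=
  Set.ncard {w : V | G.Adj v w}

open Classical in
/-- `A_α(G) = α D(G) + (1 - α) A(G)`, with `D(G)` the diagonal matrix of outdegrees. -/
noncomputable def alphaMatrix {V : Type*} (α : ℝ) (G : Digraph V) : Matrix V V ℝ :=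
  α • Matrix.diagonal (fun v => (outdegree G v : ℝ)) + (1 - α) • adjMatrix G

open Classical in
/-- The `α`-spectral radius: the largest modulus of a complex eigenvalue of `A_α(G)`. -/
noncomputable def alphaSpectralRadius {V : Type*} [Fintype V] (α : ℝ) (G : Digraph V) :
    ENNReal :=
  spectralRadius ℂ ((alphaMatrix α G).map Complex.ofReal)

section Paths

variable {B ι : Type*}

/-- The vertex at position `j` (`0 ≤ j ≤ len i`) of the `i`-th path: it starts at the branch vertex
`src i`, ends at the branch vertex `tgt i`, and its `len i - 1` internal vertices are its own. -/
def pathVertex (src tgt : ι → B) (len : ι → ℕ) (i : ι) (j : ℕ) :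
    B ⊕ (Σ i : ι, Fin (len i - 1)) :=
  if j = 0 then Sum.inl (src i)
  else if h : j - 1 < len i - 1 then Sum.inr ⟨i, ⟨j - 1, h⟩⟩
  else Sum.inl (tgt i)

/-- The digraph obtained from the set `B` of branch vertices by adding, for every `i`, a directed
path of length `len i` from `src i` to `tgt i`, all these paths being internally disjoint
(a directed cycle of length `len i` through `src i` if `src i = tgt i`). -/
def pathUnion (src tgt : ι → B) (len : ι → ℕ) : Digraph (B ⊕ (Σ i : ι, Fin (len i - 1))) where
  Adj x y := ∃ i : ι, ∃ j : ℕ, j < len i ∧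
    x = pathVertex src tgt len i j ∧ y = pathVertex src tgt len i (j + 1)

end Paths

/-- The rose digraph of `p`: directed cycles of lengths `p 0, …, p (k - 1)`, disjoint except for
one vertex that is common to all of them. -/
def rose {k : ℕ} (p : Fin k → ℕ) : Digraph (Unit ⊕ (Σ i : Fin k, Fin (p i - 1))) :=
  pathUnion (fun _ => ()) (fun _ => ()) p

/-- The generalized theta digraph of `(K₁, K₂)`: two vertices `u = false` and `v = true`, internally
disjoint directed paths from `u` to `v` of the lengths in `K₁`, and from `v` to `u` of the
lengths in `K₂`. -/
def theta {s t : ℕ} (K₁ : Fin s → ℕ) (K₂ : Fin t → ℕ) :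
    Digraph (Bool ⊕ (Σ i : Fin s ⊕ Fin t, Fin (Sum.elim K₁ K₂ i - 1))) :=
  pathUnion (Sum.elim (fun _ => false) (fun _ => true))
    (Sum.elim (fun _ => true) (fun _ => false)) (Sum.elim K₁ K₂)

/-- Partitions `x 0 ≥ ⋯ ≥ x (k - 1) ≥ 2` of `m`. -/
def IsRosePartition (m k : ℕ) (x : Fin k → ℕ) : Prop :=
  Antitone x ∧ (∀ i, 2 ≤ x i) ∧ ∑ i, x i = m

/-- Partitions `x 0 ≥ ⋯ ≥ x (t - 1) ≥ 1` of `m` in which every part but the last is at least `2`. -/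
def IsThetaPartition (m t : ℕ) (x : Fin t → ℕ) : Prop :=
  Antitone x ∧ (∀ i, 1 ≤ x i) ∧ (∀ i : Fin t, i.val + 1 < t → 2 ≤ x i) ∧ ∑ i, x i = m

/-- Digraphs with the same arcs up to a bijection of the vertices. -/
def IsIsomorphic {V W : Type*} (G : Digraph V) (H : Digraph W) : Prop :=
  Nonempty (G.Adj ≃r H.Adj)

/-- Membership in the class of rose digraphs with `k` cycles and `m` arcs. -/
def InRose (m k : ℕ) {V : Type*} (G : Digraph V) : Prop :=
  ∃ p : Fin k → ℕ, IsRosePartition m k p ∧ IsIsomorphic G (rose p)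

/-- Membership in the class of generalized theta digraphs with `m` arcs, `s` paths in one
direction and `t` in the other. -/
def InThetaST (m s t : ℕ) {V : Type*} (G : Digraph V) : Prop :=
  ∃ m₁ m₂ : ℕ, m₁ + m₂ = m ∧ ∃ (K₁ : Fin s → ℕ) (K₂ : Fin t → ℕ),
    IsThetaPartition m₁ s K₁ ∧ IsThetaPartition m₂ t K₂ ∧ IsIsomorphic G (theta K₁ K₂)

/-- Membership in the class of all generalized theta digraphs with `k` paths and `m` arcs. -/
def InTheta (m k : ℕ) {V : Type*} (G : Digraph V) : Prop :=
  ∃ s t : ℕ, 1 ≤ s ∧ 1 ≤ t ∧ s + t = k ∧ InThetaST m s t G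

/-- Membership in the class of generalized theta digraphs with `m` arcs, `k - 1` paths in one
direction and a single path in the other. -/
def InThetaOne (m k : ℕ) {V : Type*} (G : Digraph V) : Prop :=
  InThetaST m (k - 1) 1 G

/-- The partition `(m - 2k + 2, 2, …, 2)` of `m` into `k` parts (for `2k ≤ m`). -/
def gammaOne (m k : ℕ) : Fin k → ℕ :=
  fun i => if i.val = 0 then m - 2 * k + 2 else 2

/-- The vector `(2, …, 2, 1)` with `t` entries. -/
def zeta (t : ℕ) : Fin t → ℕ :=
  fun i => if i.val + 1 = t then 1 else 2

/-- The generalized theta digraph with `m` arcs, paths of the lengths in `K₁` in one direction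
and a single path, of the remaining length, in the other. -/
def thetaOne {s : ℕ} (m : ℕ) (K₁ : Fin s → ℕ) :
    Digraph (Bool ⊕ (Σ i : Fin s ⊕ Fin 1, Fin (Sum.elim K₁ (fun _ => m - ∑ j, K₁ j) i - 1))) :=
  theta K₁ (fun _ : Fin 1 => m - ∑ j, K₁ j)

end AlphaSpectral

/-! A nonnegative matrix with a positive eigenvector has that eigenvalue as its spectral radius, so
it suffices to exhibit one. Write the eigenvalue as `α + (1 - α) / t`. Vertices inside a path have
outdegree one, hence along a path the eigenvector is geometric with ratio `t`, and only the
equations at the branch vertices remain (`alphaSpectralRadius_pathUnion`). With `c = α / (1 - α)`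
they reduce to `∑ t ^ p i + c (k - 1) t = 1` for a rose, and to `(1 - c (s - 1) t) (1 - c (r - 1) t)
= (∑ t ^ K₁ i) (∑ t ^ K₂ i)` for a theta digraph. A larger root `t` means a smaller radius, so
digraphs are compared by inserting the root of one into the equation of another.

Maximum: moving all excess over 2 into one part increases `∑ t ^ p i`, because `(1 - t ^ a) (1 - t ^
b) > 0`. For thetas, each path sum is bounded by that of `(2, …, 2, 1)`, and `theta_root_inequality`
then shows that the left side of the extremal rose's equation exceeds 1.

Minimum: with a single return path the theta equation has the rose form, its exponents being the
cycle lengths `K₁ i + K₂ 0`. The vector `zeta` makes all of these as long as possible at once. For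
`k = 2` every theta is a directed cycle, so uniqueness holds only up to isomorphism. -/

namespace AlphaSpectral

/-! ### Perron-type criterion and invariance under isomorphism -/

/-- A nonnegative matrix with a positive eigenvector has the eigenvalue as spectral radius. -/
theorem spectralRadius_map_ofReal_of_mulVec_eq {V : Type*} [Fintype V] [DecidableEq V]
    [Nonempty V] (M : Matrix V V ℝ) (hM : ∀ i j, 0 ≤ M i j) (x : V → ℝ) (hx : ∀ i, 0 < x i)
    (r : ℝ) (h : M.mulVec x = r • x) :
    spectralRadius ℂ (M.map Complex.ofReal) = ENNReal.ofReal r := by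
  have hrow : ∀ i, ∑ j, M i j * x j = r * x i := fun i => by
    simpa [Matrix.mulVec, dotProduct] using congrFun h i
  have hmem : ∀ z : ℂ, z ∈ spectrum ℂ (M.map Complex.ofReal) ↔
      ∃ y : V → ℂ, y ≠ 0 ∧ (M.map Complex.ofReal).mulVec y = z • y := by
    intro z
    rw [← Matrix.spectrum_toLin', ← Module.End.hasEigenvalue_iff_mem_spectrum]
    constructor
    · intro hz
      obtain ⟨y, hy⟩ := hz.exists_hasEigenvector
      exact ⟨y, hy.2, by simpa using hy.apply_eq_smul⟩
    · rintro ⟨y, hy0, hy⟩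
      exact Module.End.hasEigenvalue_of_hasEigenvector
        (Module.End.hasEigenvector_iff.2 ⟨Module.End.mem_eigenspace_iff.2 (by simpa using hy), hy0⟩)
  have hr : 0 ≤ r := by
    obtain ⟨i⟩ := ‹Nonempty V›
    have : 0 ≤ r * x i := by
      rw [← hrow]
      exact Finset.sum_nonneg fun j _ => mul_nonneg (hM i j) (hx j).le
    exact nonneg_of_mul_nonneg_left this (hx i)
  apply le_antisymm
  · refine iSup₂_le fun z hz => ?_
    obtain ⟨y, hy0, hy⟩ := (hmem z).1 hz
    -- At an index maximizing `‖y i‖ / x i`, the triangle inequality in row `i` compares `y` with a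
    -- multiple of `x` and gives `‖z‖ ≤ r`.
    obtain ⟨i, hi⟩ := Finite.exists_max fun i => ‖y i‖ / x i
    have hle : ∀ j, ‖y j‖ ≤ ‖y i‖ / x i * x j := fun j => by
      have := hi j
      rwa [div_le_iff₀ (hx j)] at this
    have hpos : 0 < ‖y i‖ := by
      by_contra hcon
      have h0 : ‖y i‖ = 0 := le_antisymm (not_lt.1 hcon) (norm_nonneg _)
      apply hy0
      funext j
      have := hle j
      rw [h0] at this
      simpa using this
    have hzi : ∑ j, (M i j : ℂ) * y j = z * y i := by
      simpa [Matrix.mulVec, dotProduct] using congrFun hy i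
    have key : ‖z‖ * ‖y i‖ ≤ r * ‖y i‖ := by
      calc ‖z‖ * ‖y i‖ = ‖∑ j, (M i j : ℂ) * y j‖ := by rw [hzi, norm_mul]
        _ ≤ ∑ j, ‖(M i j : ℂ) * y j‖ := norm_sum_le _ _
        _ ≤ ∑ j, M i j * (‖y i‖ / x i * x j) := by
          refine Finset.sum_le_sum fun j _ => ?_
          rw [norm_mul, Complex.norm_real, Real.norm_of_nonneg (hM i j)]
          exact mul_le_mul_of_nonneg_left (hle j) (hM i j)
        _ = ‖y i‖ / x i * ∑ j, M i j * x j := by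
          rw [Finset.mul_sum]
          exact Finset.sum_congr rfl fun j _ => by ring
        _ = r * ‖y i‖ := by
          rw [hrow]
          have := (hx i).ne'
          field_simp
    have hzr : ‖z‖ ≤ r := le_of_mul_le_mul_right key hpos
    rw [← ENNReal.ofReal_coe_nnreal]
    exact ENNReal.ofReal_le_ofReal hzr
  · have hz : (r : ℂ) ∈ spectrum ℂ (M.map Complex.ofReal) := by
      refine (hmem _).2 ⟨fun i => (x i : ℂ), ?_, ?_⟩
      · obtain ⟨i⟩ := ‹Nonempty V›
        intro h0
        have := congrFun h0 i
        simp only [Pi.zero_apply, Complex.ofReal_eq_zero] at this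
        exact (hx i).ne' this
      · funext i
        simp only [Matrix.mulVec, dotProduct, Matrix.map_apply, Pi.smul_apply, smul_eq_mul]
        exact_mod_cast hrow i
    refine le_trans ?_ (le_iSup₂ (f := fun (z : ℂ) (_ : z ∈ spectrum ℂ (M.map Complex.ofReal)) =>
      (‖z‖₊ : ENNReal)) (r : ℂ) hz)
    rw [← ENNReal.ofReal_coe_nnreal]
    refine ENNReal.ofReal_le_ofReal ?_
    simp [abs_of_nonneg hr]

theorem outdegree_eq_of_iso {V W : Type*} {G : Digraph V} {H : Digraph W}
    (e : G.Adj ≃r H.Adj) (v : V) : outdegree H (e v) = outdegree G v := by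
  unfold outdegree
  rw [← Set.ncard_image_of_injective {w | G.Adj v w} e.injective]
  congr 1
  ext w
  simp only [Set.mem_ofPred_eq, Set.mem_image]
  constructor
  · intro h
    exact ⟨e.symm w, by rw [← e.map_rel_iff]; simpa using h, by simp⟩
  · rintro ⟨u, hu, rfl⟩
    exact e.map_rel_iff.2 hu

theorem alphaSpectralRadius_eq_of_isIsomorphic {V W : Type*} [Fintype V] [Fintype W]
    {G : Digraph V} {H : Digraph W} (α : ℝ) (h : IsIsomorphic G H) :
    alphaSpectralRadius α G = alphaSpectralRadius α H := by
  classical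
  obtain ⟨e⟩ := h
  have hM : (alphaMatrix α H).map Complex.ofReal =
      Matrix.reindexAlgEquiv ℂ ℂ e.toEquiv ((alphaMatrix α G).map Complex.ofReal) := by
    ext i j
    obtain ⟨i, rfl⟩ := e.surjective i
    obtain ⟨j, rfl⟩ := e.surjective j
    have h1 : ∀ v, e.toEquiv.symm (e v) = v := fun v => e.toEquiv.symm_apply_apply v
    simp only [Matrix.map_apply, Matrix.coe_reindexAlgEquiv, Matrix.reindex_apply,
      Matrix.submatrix_apply, h1, alphaMatrix, Matrix.add_apply, Matrix.smul_apply, adjMatrix,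
      Matrix.of_apply, Matrix.diagonal_apply, e.map_rel_iff, outdegree_eq_of_iso,
      e.injective.eq_iff]
  unfold alphaSpectralRadius spectralRadius
  rw [hM]
  have := AlgEquiv.spectrum_eq (Matrix.reindexAlgEquiv ℂ ℂ e.toEquiv)
    ((alphaMatrix α G).map Complex.ofReal)
  convert rfl

theorem alphaMatrix_mulVec_of_succ {V κ : Type*} [Fintype V] [Fintype κ] (α : ℝ) (G : Digraph V)
    (x : V → ℝ) (v : V) (f : κ → V) (hf : Function.Injective f)
    (hadj : ∀ w, G.Adj v w ↔ ∃ i, w = f i) :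
    (alphaMatrix α G).mulVec x v =
      α * (Fintype.card κ * x v) + (1 - α) * ∑ i, x (f i) := by
  classical
  have hd : outdegree G v = Fintype.card κ := by
    unfold outdegree
    have : {w | G.Adj v w} = Set.range f := by
      ext w
      simp [hadj, eq_comm]
    rw [this, ← Set.image_univ, Set.ncard_image_of_injective _ hf, Set.ncard_univ,
      Nat.card_eq_fintype_card]
  have hs : ∑ w, adjMatrix G v w * x w = ∑ i, x (f i) := by
    have h1 : ∀ w, adjMatrix G v w * x w = if w ∈ Finset.univ.image f then x w else 0 := by
      intro w
      simp [adjMatrix, hadj, eq_comm]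
    simp_rw [h1]
    rw [Finset.sum_ite_mem, Finset.univ_inter, Finset.sum_image hf.injOn]
  rw [alphaMatrix, Matrix.add_mulVec, Matrix.smul_mulVec, Matrix.smul_mulVec, ← hs]
  simp only [Pi.add_apply, Pi.smul_apply, smul_eq_mul, Matrix.mulVec_diagonal, hd]
  rfl

theorem alphaMatrix_nonneg {V : Type*} {α : ℝ} (h0 : 0 ≤ α) (h1 : α < 1) (G : Digraph V)
    (i j : V) : 0 ≤ alphaMatrix α G i j := by
  classical
  simp only [alphaMatrix, Matrix.add_apply, Matrix.smul_apply, smul_eq_mul, adjMatrix,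
    Matrix.of_apply, Matrix.diagonal_apply]
  have : 0 ≤ 1 - α := by linarith
  split_ifs <;> positivity

theorem alphaSpectralRadius_of_mulVec_eq {V : Type*} [Fintype V] [Nonempty V] {α : ℝ}
    (h0 : 0 ≤ α) (h1 : α < 1) (G : Digraph V) (x : V → ℝ) (hx : ∀ v, 0 < x v) (r : ℝ)
    (h : ∀ v, (alphaMatrix α G).mulVec x v = r * x v) :
    alphaSpectralRadius α G = ENNReal.ofReal r := by
  classical
  unfold alphaSpectralRadius
  convert spectralRadius_map_ofReal_of_mulVec_eq _ (alphaMatrix_nonneg h0 h1 G) x hx r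
    (funext h)

/-! ### Eigenvectors on unions of paths -/

section Paths

variable {B ι : Type*}

theorem pathVertex_zero (src tgt : ι → B) (len : ι → ℕ) (i : ι) :
    pathVertex src tgt len i 0 = Sum.inl (src i) := by
  simp [pathVertex]

theorem pathVertex_internal (src tgt : ι → B) (len : ι → ℕ) (i : ι) (j : ℕ) (h : j < len i - 1) :
    pathVertex src tgt len i (j + 1) = Sum.inr ⟨i, ⟨j, h⟩⟩ := by
  simp [pathVertex, h]

theorem pathVertex_last (src tgt : ι → B) (len : ι → ℕ) (i : ι) (j : ℕ) (h : len i = j + 1) :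
    pathVertex src tgt len i (j + 1) = Sum.inl (tgt i) := by
  simp [pathVertex, h]

theorem pathUnion_adj_inl (src tgt : ι → B) (len : ι → ℕ) (hlen : ∀ i, 1 ≤ len i) (b : B)
    (w : B ⊕ (Σ i : ι, Fin (len i - 1))) :
    (pathUnion src tgt len).Adj (Sum.inl b) w ↔
      ∃ i : {i // src i = b}, w = pathVertex src tgt len i.1 1 := by
  constructor
  · rintro ⟨i, j, hj, hb, hw⟩
    cases j with
    | zero =>
      rw [pathVertex_zero, Sum.inl.injEq] at hb
      exact ⟨⟨i, hb.symm⟩, hw⟩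
    | succ j =>
      rw [pathVertex_internal _ _ _ _ _ (by omega)] at hb
      cases hb
  · rintro ⟨⟨i, hi⟩, hw⟩
    exact ⟨i, 0, hlen i, by rw [pathVertex_zero, hi], hw⟩

theorem pathUnion_adj_inr (src tgt : ι → B) (len : ι → ℕ) (i : ι) (j : Fin (len i - 1))
    (w : B ⊕ (Σ i : ι, Fin (len i - 1))) :
    (pathUnion src tgt len).Adj (Sum.inr ⟨i, j⟩) w ↔
      w = pathVertex src tgt len i (j.1 + 2) := by
  constructor
  · rintro ⟨i', j', hj, hb, hw⟩
    cases j' with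
    | zero =>
      rw [pathVertex_zero] at hb
      cases hb
    | succ j' =>
      rw [pathVertex_internal _ _ _ _ _ (by omega)] at hb
      cases hb
      exact hw
  · intro hw
    have := j.2
    exact ⟨i, j.1 + 1, by omega, by rw [pathVertex_internal _ _ _ _ _ j.2], hw⟩

/-- The weights extending `y` to the internal vertices of the paths by a factor `t` per arc. -/
def pathWeight (tgt : ι → B) (len : ι → ℕ) (t : ℝ) (y : B → ℝ) :
    B ⊕ (Σ i : ι, Fin (len i - 1)) → ℝ :=
  Sum.elim y fun p => t ^ (len p.1 - 1 - p.2.1) * y (tgt p.1)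

theorem pathWeight_pathVertex (src tgt : ι → B) (len : ι → ℕ) (t : ℝ) (y : B → ℝ) (i : ι) (j : ℕ)
    (hj : j + 1 ≤ len i) :
    pathWeight tgt len t y (pathVertex src tgt len i (j + 1)) =
      t ^ (len i - (j + 1)) * y (tgt i) := by
  rcases hj.lt_or_eq with h | h
  · rw [pathVertex_internal _ _ _ _ _ (by omega)]
    simp only [pathWeight, Sum.elim_inr]
    congr 2
    omega
  · rw [pathVertex_last _ _ _ _ _ h.symm, ← h]
    simp [pathWeight]

/-- Two length-one paths with the same ends would collapse to one arc. Excluding this makes the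
outdegree of a branch vertex equal to the number of paths leaving it. -/
theorem pathVertex_one_injective (src tgt : ι → B) (len : ι → ℕ) (hlen : ∀ i, 1 ≤ len i)
    (hinj : ∀ i j, src i = src j → len i = 1 → len j = 1 → tgt i = tgt j → i = j) (b : B) :
    Function.Injective fun i : {i // src i = b} => pathVertex src tgt len i.1 (0 + 1) := by
  rintro ⟨i, hi⟩ ⟨i', hi'⟩ h
  have hl := hlen i
  have hl' := hlen i'
  simp only [Subtype.mk.injEq]
  simp only at h
  rcases hl.lt_or_eq with a | a <;> rcases hl'.lt_or_eq with a' | a'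
  · rw [pathVertex_internal _ _ _ _ _ (by omega),
      pathVertex_internal _ _ _ _ _ (by omega)] at h
    exact congrArg Sigma.fst (Sum.inr.inj h)
  · rw [pathVertex_internal _ _ _ _ _ (by omega),
      pathVertex_last _ _ _ _ _ a'.symm] at h
    cases h
  · rw [pathVertex_last _ _ _ _ _ a.symm,
      pathVertex_internal _ _ _ _ _ (by omega)] at h
    cases h
  · rw [pathVertex_last _ _ _ _ _ a.symm,
      pathVertex_last _ _ _ _ _ a'.symm, Sum.inl.injEq] at h
    exact hinj _ _ (hi.trans hi'.symm) a.symm a'.symm h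

/-- The hypothesis `heq` is the eigenvalue equation at the branch vertices, multiplied by `t / (1 -
α)`; the weights `pathWeight` satisfy the other equations automatically. -/
theorem alphaSpectralRadius_pathUnion [Fintype B] [Fintype ι] [Nonempty B] [DecidableEq B]
    (src tgt : ι → B) (len : ι → ℕ) (hlen : ∀ i, 1 ≤ len i)
    (hinj : ∀ i j, src i = src j → len i = 1 → len j = 1 → tgt i = tgt j → i = j)
    {α t : ℝ} (h0 : 0 ≤ α) (h1 : α < 1) (ht : 0 < t) (y : B → ℝ) (hy : ∀ b, 0 < y b)
    (heq : ∀ b, (1 - α / (1 - α) * ((Fintype.card {i // src i = b} : ℝ) - 1) * t) * y b =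
      ∑ i : {i // src i = b}, t ^ len i.1 * y (tgt i.1)) :
    alphaSpectralRadius α (pathUnion src tgt len) = ENNReal.ofReal (α + (1 - α) / t) := by
  have hβ : (1 - α) ≠ 0 := by linarith
  have ht0 := ht.ne'
  refine alphaSpectralRadius_of_mulVec_eq h0 h1 _ (pathWeight tgt len t y) ?_ _ ?_
  · rintro (b | ⟨i, j⟩)
    · exact hy b
    · exact mul_pos (pow_pos ht _) (hy _)
  · rintro (b | ⟨i, j⟩)
    · have hf := pathVertex_one_injective src tgt len hlen hinj b
      rw [alphaMatrix_mulVec_of_succ α _ _ _ _ hf (pathUnion_adj_inl src tgt len hlen b)]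
      have hs : ∑ i : {i // src i = b},
          pathWeight tgt len t y (pathVertex src tgt len i.1 (0 + 1)) =
          (1 / t) * ∑ i : {i // src i = b}, t ^ len i.1 * y (tgt i.1) := by
        rw [Finset.mul_sum]
        refine Finset.sum_congr rfl fun i _ => ?_
        rw [pathWeight_pathVertex _ _ _ _ _ _ _ (hlen i.1)]
        obtain ⟨n, hn⟩ := Nat.exists_eq_add_of_le' (hlen i.1)
        rw [hn, pow_succ]
        simp only [zero_add, Nat.add_sub_cancel]
        field_simp
      rw [hs, ← heq]
      simp only [pathWeight, Sum.elim_inl]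
      field_simp
      ring
    · rw [alphaMatrix_mulVec_of_succ α _ _ _
        (fun _ : Unit => pathVertex src tgt len i (j.1 + 1 + 1)) (fun _ _ _ => rfl)
        (fun w => by rw [pathUnion_adj_inr]; simp)]
      have hj := j.2
      simp only [Fintype.card_unit, Finset.univ_unique, Finset.sum_singleton]
      rw [pathWeight_pathVertex _ _ _ _ _ _ _ (by omega)]
      simp only [pathWeight, Sum.elim_inr]
      obtain ⟨n, hn⟩ : ∃ n, len i - 1 - j.1 = n + 1 := ⟨len i - 1 - j.1 - 1, by omega⟩
      rw [hn, show len i - (j.1 + 1 + 1) = n by omega, pow_succ]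
      push_cast
      field_simp

end Paths

/-! ### Characteristic equations of roses and thetas, and their roots -/

theorem alphaSpectralRadius_rose {k : ℕ} (p : Fin k → ℕ) (hp : ∀ i, 2 ≤ p i) {α t : ℝ}
    (h0 : 0 ≤ α) (h1 : α < 1) (ht : 0 < t)
    (h : ∑ i, t ^ p i + α / (1 - α) * ((k : ℝ) - 1) * t = 1) :
    alphaSpectralRadius α (rose p) = ENNReal.ofReal (α + (1 - α) / t) := by
  refine alphaSpectralRadius_pathUnion _ _ p (fun i => (hp i).trans' one_le_two)
    (fun i j _ hi => absurd hi (by have := hp i; omega)) h0 h1 ht (fun _ => 1)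
    (fun _ => one_pos) fun b => ?_
  have hc : Fintype.card {i : Fin k // (fun _ : Fin k => ()) i = b} = k := by
    simp [Fintype.card_subtype]
  have hs : ∑ i : {i : Fin k // (fun _ : Fin k => ()) i = b}, t ^ p i.1 = ∑ i, t ^ p i :=
    Fintype.sum_equiv (Equiv.subtypeUnivEquiv fun _ => rfl) _ _ fun _ => rfl
  rw [hc]
  simp only [mul_one]
  rw [hs]
  linarith

theorem exists_rose_root {k : ℕ} (p : Fin k → ℕ) (hp : ∀ i, 2 ≤ p i) (hk : 1 ≤ k) {c : ℝ}
    (hc : 0 ≤ c) :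
    ∃ t : ℝ, 0 < t ∧ t ≤ 1 ∧ ∑ i, t ^ p i + c * ((k : ℝ) - 1) * t = 1 := by
  have hk' : (1 : ℝ) ≤ k := by exact_mod_cast hk
  have hcont : ContinuousOn (fun t : ℝ => ∑ i, t ^ p i + c * ((k : ℝ) - 1) * t)
      (Set.Icc 0 1) := by fun_prop
  have hf0 : ∑ i, (0 : ℝ) ^ p i + c * ((k : ℝ) - 1) * 0 = 0 := by
    rw [mul_zero, add_zero]
    exact Finset.sum_eq_zero fun i _ => zero_pow (by have := hp i; omega)
  have hf1 : 1 ≤ ∑ i, (1 : ℝ) ^ p i + c * ((k : ℝ) - 1) * 1 := by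
    simp only [one_pow, Finset.sum_const, Finset.card_univ, Fintype.card_fin, nsmul_eq_mul]
    have : 0 ≤ c * ((k : ℝ) - 1) := mul_nonneg hc (by linarith)
    linarith
  obtain ⟨t, ht, hft⟩ := intermediate_value_Icc zero_le_one hcont
    (show (1 : ℝ) ∈ Set.Icc _ _ from ⟨hf0.trans_le zero_le_one, hf1⟩)
  refine ⟨t, ht.1.lt_of_ne ?_, ht.2, hft⟩
  rintro rfl
  simp only [hf0] at hft
  exact zero_ne_one hft

theorem alphaSpectralRadius_theta {s r : ℕ} (K₁ : Fin s → ℕ) (K₂ : Fin r → ℕ)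
    (hs : 1 ≤ s)
    (hK₁ : ∀ i, 1 ≤ K₁ i) (hK₂ : ∀ i, 1 ≤ K₂ i)
    (hu₁ : ∀ i j, K₁ i = 1 → K₁ j = 1 → i = j) (hu₂ : ∀ i j, K₂ i = 1 → K₂ j = 1 → i = j)
    {α t : ℝ} (h0 : 0 ≤ α) (h1 : α < 1) (ht : 0 < t)
    (hpos : 0 < 1 - α / (1 - α) * ((s : ℝ) - 1) * t)
    (h : (1 - α / (1 - α) * ((s : ℝ) - 1) * t) * (1 - α / (1 - α) * ((r : ℝ) - 1) * t) =
      (∑ i, t ^ K₁ i) * ∑ i, t ^ K₂ i) :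
    alphaSpectralRadius α (theta K₁ K₂) = ENNReal.ofReal (α + (1 - α) / t) := by
  have hX : 0 < ∑ i, t ^ K₁ i :=
    Finset.sum_pos (fun i _ => pow_pos ht _) ⟨⟨0, hs⟩, Finset.mem_univ _⟩
  refine alphaSpectralRadius_pathUnion _ _ _ (Sum.rec hK₁ hK₂) ?_ h0 h1 ht
    -- The equation at `u` fixes the ratio of the two branch weights, and `h` is then the equation
    -- at `v`.
    (fun b => bif b then 1 - α / (1 - α) * ((s : ℝ) - 1) * t else ∑ i, t ^ K₁ i) ?_ ?_
  · rintro (i | i) (j | j) hij hi hj _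
    · rw [hu₁ i j hi hj]
    · cases hij
    · cases hij
    · rw [hu₂ i j hi hj]
  · rintro (_ | _)
    · exact hX
    · exact hpos
  · rintro (_ | _)
    · let e : Fin s ≃ {i : Fin s ⊕ Fin r //
          Sum.elim (fun _ : Fin s => false) (fun _ : Fin r => true) i = false} :=
        { toFun := fun i => ⟨Sum.inl i, rfl⟩
          invFun := fun i => match i with
            | ⟨Sum.inl i, _⟩ => i
            | ⟨Sum.inr i, h⟩ => absurd h (by simp)
          left_inv := fun i => rfl
          right_inv := by
            rintro ⟨i | i, h⟩
            · rfl
            · exact absurd h (by simp) }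
      rw [← Fintype.card_congr e, ← e.sum_comp]
      simp only [Fintype.card_fin, cond_false]
      change _ = ∑ i, t ^ K₁ i * (1 - α / (1 - α) * ((s : ℝ) - 1) * t)
      rw [← Finset.sum_mul]
      ring
    · let e : Fin r ≃ {i : Fin s ⊕ Fin r //
          Sum.elim (fun _ : Fin s => false) (fun _ : Fin r => true) i = true} :=
        { toFun := fun i => ⟨Sum.inr i, rfl⟩
          invFun := fun i => match i with
            | ⟨Sum.inr i, _⟩ => i
            | ⟨Sum.inl i, h⟩ => absurd h (by simp)
          left_inv := fun i => rfl
          right_inv := by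
            rintro ⟨i | i, h⟩
            · exact absurd h (by simp)
            · rfl }
      rw [← Fintype.card_congr e, ← e.sum_comp]
      simp only [Fintype.card_fin, cond_true]
      change _ = ∑ i, t ^ K₂ i * ∑ i, t ^ K₁ i
      rw [← Finset.sum_mul]
      linarith

theorem exists_theta_root {s r : ℕ} (K₁ : Fin s → ℕ) (K₂ : Fin r → ℕ)
    (hs : 1 ≤ s) (hr : 1 ≤ r) (hK₁ : ∀ i, 1 ≤ K₁ i) {c : ℝ} (hc : 0 ≤ c) :
    ∃ t : ℝ, 0 < t ∧ t ≤ 1 ∧ 0 < 1 - c * ((s : ℝ) - 1) * t ∧ 0 < 1 - c * ((r : ℝ) - 1) * t ∧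
      (1 - c * ((s : ℝ) - 1) * t) * (1 - c * ((r : ℝ) - 1) * t) =
        (∑ i, t ^ K₁ i) * ∑ i, t ^ K₂ i := by
  have hs' : (1 : ℝ) ≤ s := by exact_mod_cast hs
  have hr' : (1 : ℝ) ≤ r := by exact_mod_cast hr
  have ha : 0 ≤ c * ((s : ℝ) - 1) := mul_nonneg hc (by linarith)
  have hb : 0 ≤ c * ((r : ℝ) - 1) := mul_nonneg hc (by linarith)
  set a := c * ((s : ℝ) - 1)
  set b := c * ((r : ℝ) - 1)
  have hX : ∀ t : ℝ, 0 < t → 0 < ∑ i, t ^ K₁ i := fun t ht =>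
    Finset.sum_pos (fun i _ => pow_pos ht _) ⟨⟨0, hs⟩, Finset.mem_univ _⟩
  have hY : ∀ t : ℝ, 0 < t → 0 < ∑ i, t ^ K₂ i := fun t ht =>
    Finset.sum_pos (fun i _ => pow_pos ht _) ⟨⟨0, hr⟩, Finset.mem_univ _⟩
  -- With `M = max 1 (max a b)`, both linear factors stay nonnegative on `[0, M⁻¹]`. At `M⁻¹` either
  -- a factor vanishes, or `M = 1` and the product of path sums is `s * r ≥ 1`; so the difference
  -- changes sign.
  obtain ⟨M, hM1, haM, hbM, hM⟩ : ∃ M : ℝ, 1 ≤ M ∧ a ≤ M ∧ b ≤ M ∧ (M = 1 ∨ M = a ∨ M = b) := by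
    refine ⟨max 1 (max a b), by simp, by simp, by simp, ?_⟩
    rcases max_choice 1 (max a b) with h | h
    · exact Or.inl h
    · rw [h]
      exact Or.inr (max_choice a b)
  have hM0 : 0 < M := by linarith
  have hMi : M⁻¹ ≤ 1 := inv_le_one_of_one_le₀ hM1
  have hcont : ContinuousOn (fun t : ℝ => (1 - a * t) * (1 - b * t) -
      (∑ i, t ^ K₁ i) * ∑ i, t ^ K₂ i) (Set.Icc 0 M⁻¹) := by fun_prop
  have hf0 : (1 - a * 0) * (1 - b * 0) -
      (∑ i, (0 : ℝ) ^ K₁ i) * ∑ i, (0 : ℝ) ^ K₂ i = 1 := by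
    rw [Finset.sum_eq_zero fun i _ => zero_pow (by have := hK₁ i; omega)]
    ring
  have hfM : (1 - a * M⁻¹) * (1 - b * M⁻¹) -
      (∑ i, M⁻¹ ^ K₁ i) * ∑ i, M⁻¹ ^ K₂ i ≤ 0 := by
    rcases hM with h | h | h
    · rw [h] at haM hbM ⊢
      simp only [inv_one, one_pow, Finset.sum_const, Finset.card_univ, Fintype.card_fin,
        nsmul_eq_mul, mul_one]
      nlinarith
    · rw [← h, mul_inv_cancel₀ hM0.ne']
      have := mul_pos (hX _ (inv_pos.2 hM0)) (hY _ (inv_pos.2 hM0))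
      linarith
    · rw [← h, mul_inv_cancel₀ hM0.ne']
      have := mul_pos (hX _ (inv_pos.2 hM0)) (hY _ (inv_pos.2 hM0))
      linarith
  obtain ⟨t, ht, hft⟩ := intermediate_value_Icc' (inv_pos.2 hM0).le hcont
    (show (0 : ℝ) ∈ Set.Icc _ _ from ⟨hfM, hf0.symm.le.trans' zero_le_one⟩)
  have ht0 : 0 < t := by
    refine ht.1.lt_of_ne ?_
    rintro rfl
    simp only [hf0] at hft
    exact one_ne_zero hft
  have hprod : (1 - a * t) * (1 - b * t) = (∑ i, t ^ K₁ i) * ∑ i, t ^ K₂ i := sub_eq_zero.1 hft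
  have hpp : 0 < (1 - a * t) * (1 - b * t) := hprod ▸ mul_pos (hX t ht0) (hY t ht0)
  have hA : ∀ z, 0 ≤ z → z ≤ M → 0 ≤ 1 - z * t := fun z hz hzM => by
    have h1 : z * t ≤ M * M⁻¹ := mul_le_mul hzM ht.2 ht0.le hM0.le
    rw [mul_inv_cancel₀ hM0.ne'] at h1
    linarith
  have hA0 := hA a ha haM
  have hB0 := hA b hb hbM
  refine ⟨t, ht0, ht.2.trans hMi, hA0.lt_of_ne ?_, hB0.lt_of_ne ?_, hprod⟩
  · intro h
    rw [← h, zero_mul] at hpp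
    exact hpp.false
  · intro h
    rw [← h, mul_zero] at hpp
    exact hpp.false

theorem ofReal_add_div_le_iff {α t u : ℝ} (h0 : 0 ≤ α) (h1 : α < 1) (ht : 0 < t) (hu : 0 < u) :
    ENNReal.ofReal (α + (1 - α) / t) ≤ ENNReal.ofReal (α + (1 - α) / u) ↔ u ≤ t := by
  have h2 : 0 < 1 - α := by linarith
  rw [ENNReal.ofReal_le_ofReal_iff (by positivity), add_le_add_iff_left,
    div_le_div_iff_of_pos_left h2 ht hu]

/-! ### Power sums and the inequality between theta and rose -/

/-- Subadditivity of `q ↦ 1 - t ^ q`, from `(1 - t ^ a) (1 - t ^ b) ≥ 0`. -/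
theorem one_sub_pow_sum_le {ι : Type*} (s : Finset ι) (q : ι → ℕ) {t : ℝ} (ht : 0 ≤ t)
    (ht1 : t ≤ 1) : 1 - t ^ ∑ i ∈ s, q i ≤ ∑ i ∈ s, (1 - t ^ q i) := by
  classical
  induction s using Finset.induction_on with
  | empty => simp
  | insert a s ha ih =>
    rw [Finset.sum_insert ha, Finset.sum_insert ha, pow_add]
    have h1 : t ^ q a ≤ 1 := pow_le_one₀ ht ht1
    have h2 : t ^ ∑ i ∈ s, q i ≤ 1 := pow_le_one₀ ht ht1
    nlinarith

theorem sum_pow_gammaOne (m n : ℕ) (t : ℝ) :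
    ∑ i, t ^ gammaOne m (n + 1) i = t ^ (m - 2 * (n + 1) + 2) + n * t ^ 2 := by
  rw [Fin.sum_univ_succ]
  simp [gammaOne]

theorem isRosePartition_gammaOne {m k : ℕ} (hk : 1 ≤ k) (h : 2 * k ≤ m) :
    IsRosePartition m k (gammaOne m k) := by
  refine ⟨fun i j hij => ?_, fun i => ?_, ?_⟩
  · have : i.val ≤ j.val := hij
    unfold gammaOne
    split_ifs <;> omega
  · unfold gammaOne
    split_ifs <;> omega
  · obtain ⟨n, rfl⟩ := Nat.exists_eq_add_of_le' hk
    rw [Fin.sum_univ_succ]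
    simp [gammaOne]
    omega

theorem sum_pow_lt_sum_pow_gammaOne {m k : ℕ} (hk : 1 ≤ k) {p : Fin k → ℕ}
    (hp : IsRosePartition m k p) (hne : p ≠ gammaOne m k) {t : ℝ} (ht : 0 < t) (ht1 : t < 1) :
    ∑ i, t ^ p i < ∑ i, t ^ gammaOne m k i := by
  obtain ⟨n, rfl⟩ := Nat.exists_eq_add_of_le' hk
  obtain ⟨hanti, h2, hsum⟩ := hp
  -- Here `q` is the excess over 2. The small parts are first merged into one excess `Q`, and `Q` is
  -- then merged strictly with `q 0`; both are positive, as `p` is antitone and differs from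
  -- `gammaOne`.
  obtain ⟨q, hq⟩ : ∃ q : Fin (n + 1) → ℕ, ∀ i, p i = q i + 2 :=
    ⟨fun i => p i - 2, fun i => (Nat.sub_add_cancel (h2 i)).symm⟩
  simp only [hq] at hsum
  rw [Fin.sum_univ_succ, Finset.sum_add_distrib] at hsum
  simp only [Finset.sum_const, Finset.card_univ, Fintype.card_fin, smul_eq_mul] at hsum
  set Q := ∑ i : Fin n, q i.succ with hQ
  have hQ0 : 0 < Q := by
    by_contra hcon
    have hQz : Q = 0 := by omega
    apply hne
    have hz : ∀ i : Fin n, q i.succ = 0 := fun i => by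
      rw [hQ, Finset.sum_eq_zero_iff] at hQz
      exact hQz i (Finset.mem_univ _)
    funext i
    refine Fin.cases ?_ (fun i => ?_) i
    · rw [hq]
      simp only [gammaOne, Fin.val_zero, if_true]
      omega
    · rw [hq, hz]
      simp [gammaOne]
  have hq0 : q 0 ≠ 0 := by
    obtain ⟨i, -, hi⟩ := Finset.exists_ne_zero_of_sum_ne_zero hQ0.ne'
    have := hanti (Fin.zero_le i.succ)
    rw [hq, hq] at this
    omega
  have hle := one_sub_pow_sum_le Finset.univ (fun i : Fin n => q i.succ) ht.le ht1.le
  rw [← hQ, Finset.sum_sub_distrib] at hle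
  simp only [Finset.sum_const, Finset.card_univ, Fintype.card_fin, nsmul_eq_mul, mul_one] at hle
  have ha : t ^ q 0 < 1 := pow_lt_one₀ ht.le ht1 hq0
  have hb : t ^ Q < 1 := pow_lt_one₀ ht.le ht1 hQ0.ne'
  rw [sum_pow_gammaOne, Fin.sum_univ_succ, show m - 2 * (n + 1) + 2 = q 0 + Q + 2 by omega]
  simp only [hq, pow_add, ← Finset.sum_mul]
  have ht2 : 0 < t ^ 2 := by positivity
  rw [← add_mul, ← add_mul]
  refine mul_lt_mul_of_pos_right ?_ ht2
  nlinarith [mul_pos (sub_pos.2 ha) (sub_pos.2 hb)]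

/-- In its use `σ = s - 1` and `τ = r - 1`, so `σ + τ + 1 = k - 1` and the right side is the
extremal rose's equation without its longest cycle. -/
theorem theta_root_inequality {c t σ τ : ℝ} (hc : 0 ≤ c) (ht : 0 < t) (ht1 : t ≤ 1) (hσ : 0 ≤ σ)
    (hτ : 0 ≤ τ)
    (h : (1 - c * σ * t) * (1 - c * τ * t) ≤ (t + σ * t ^ 2) * (t + τ * t ^ 2)) :
    1 ≤ (σ + τ + 1) * t ^ 2 + c * (σ + τ + 1) * t := by
  have hστ := mul_nonneg hσ hτ
  have hct := mul_nonneg hc ht.le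
  rcases le_total t c with htc | htc
  -- For `t ≤ c` the `σ * τ` terms of the expanded hypothesis can be dropped, and `t ^ 3 ≤ t ^ 2`
  -- finishes.
  · have h1 : σ * τ * t ^ 2 * t ^ 2 ≤ σ * τ * t ^ 2 * c ^ 2 := by gcongr
    have h2 : (σ + τ) * t ^ 2 * t ≤ (σ + τ) * t ^ 2 * 1 := by gcongr
    nlinarith
  -- For `c ≤ t`, replacing `σ` and `τ` by their mean preserves the inequality and makes both sides
  -- squares. The root gives `2 (1 - t) ≤ (σ + τ) t (c + t)`, while `1 - t ^ 2 ≤ 2 (1 - t)`.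
  · have h1 : 0 ≤ (σ - τ) ^ 2 * (t ^ 2 * (t ^ 2 - c ^ 2)) := by
      have : c ^ 2 ≤ t ^ 2 := by gcongr
      have : 0 ≤ t ^ 2 - c ^ 2 := by linarith
      positivity
    have h2 : (1 - c * (σ + τ) * t / 2) ^ 2 ≤ (t + (σ + τ) * t ^ 2 / 2) ^ 2 := by nlinarith
    have h3 := (le_abs_self _).trans (abs_le_of_sq_le_sq h2 (by positivity))
    nlinarith [h3, sq_nonneg (1 - t)]

/-! ### Extremality of the vector `zeta` -/

theorem IsThetaPartition.eq_of_eq_one {m s : ℕ} {K : Fin s → ℕ} (h : IsThetaPartition m s K)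
    (i j : Fin s) (hi : K i = 1) (hj : K j = 1) : i = j := by
  obtain ⟨-, -, h2, -⟩ := h
  have hi2 := h2 i
  have hj2 := h2 j
  have := i.2
  have := j.2
  ext
  omega

theorem zeta_le {m s : ℕ} {K : Fin s → ℕ} (h : IsThetaPartition m s K) (i : Fin s) :
    zeta s i ≤ K i := by
  have h1 := h.2.1 i
  have h2 := h.2.2.1 i
  have := i.2
  unfold zeta
  split_ifs <;> omega

theorem zeta_castSucc {n : ℕ} (i : Fin n) : zeta (n + 1) i.castSucc = 2 := by
  have := i.2
  simp only [zeta, Fin.val_castSucc, ite_eq_right_iff]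
  omega

theorem zeta_last (n : ℕ) : zeta (n + 1) (Fin.last n) = 1 := by
  simp [zeta]

theorem sum_zeta {s : ℕ} (hs : 1 ≤ s) : ∑ i, zeta s i = 2 * s - 1 := by
  obtain ⟨n, rfl⟩ := Nat.exists_eq_add_of_le' hs
  rw [Fin.sum_univ_castSucc]
  simp [zeta_castSucc, zeta_last]
  omega

theorem sum_pow_zeta {s : ℕ} (hs : 1 ≤ s) (t : ℝ) :
    ∑ i, t ^ zeta s i = t + ((s : ℝ) - 1) * t ^ 2 := by
  obtain ⟨n, rfl⟩ := Nat.exists_eq_add_of_le' hs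
  rw [Fin.sum_univ_castSucc]
  simp [zeta_castSucc, zeta_last]
  ring

theorem isThetaPartition_zeta {s : ℕ} (hs : 1 ≤ s) : IsThetaPartition (2 * s - 1) s (zeta s) := by
  refine ⟨fun i j hij => ?_, fun i => ?_, fun i hi => ?_, sum_zeta hs⟩
  · have : i.val ≤ j.val := hij
    have := j.2
    unfold zeta
    split_ifs <;> omega
  · unfold zeta
    split_ifs <;> omega
  · unfold zeta
    split_ifs <;> omega

theorem sum_pow_le_of_isThetaPartition {m s : ℕ} (hs : 1 ≤ s) {K : Fin s → ℕ}
    (h : IsThetaPartition m s K) {t : ℝ} (ht : 0 ≤ t) (ht1 : t ≤ 1) :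
    ∑ i, t ^ K i ≤ t + ((s : ℝ) - 1) * t ^ 2 := by
  rw [← sum_pow_zeta hs]
  exact Finset.sum_le_sum fun i _ => pow_le_pow_of_le_one ht ht1 (zeta_le h i)

/-- The excess of one entry over `zeta` is at most the total excess `m₁ - (2 * s - 1)`. -/
theorem add_le_zeta_add {m m₁ m₂ s : ℕ} (hs : 1 ≤ s) (hm : m₁ + m₂ = m) {K : Fin s → ℕ}
    (h : IsThetaPartition m₁ s K) (i : Fin s) :
    K i + m₂ ≤ zeta s i + (m - (2 * s - 1)) := by
  have h1 : ∑ j, (K j - zeta s j) + ∑ j, zeta s j = m₁ := by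
    rw [← Finset.sum_add_distrib, ← h.2.2.2]
    exact Finset.sum_congr rfl fun j _ => Nat.sub_add_cancel (zeta_le h j)
  rw [sum_zeta hs] at h1
  have h2 : K i - zeta s i ≤ ∑ j, (K j - zeta s j) :=
    Finset.single_le_sum (f := fun j => K j - zeta s j) (fun _ _ => Nat.zero_le _)
      (Finset.mem_univ i)
  omega

/-- Equality means that each entry carries the whole excess. With two entries this forces the excess
to be zero; with one it says nothing, hence `2 ≤ s`. -/
theorem eq_zeta_of_add_eq {m m₁ m₂ s : ℕ} (hs : 2 ≤ s) (hm : m₁ + m₂ = m) {K : Fin s → ℕ}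
    (h : IsThetaPartition m₁ s K) (heq : ∀ i, K i + m₂ = zeta s i + (m - (2 * s - 1))) :
    K = zeta s := by
  have h1 : ∑ j, (K j - zeta s j) + ∑ j, zeta s j = m₁ := by
    rw [← Finset.sum_add_distrib, ← h.2.2.2]
    exact Finset.sum_congr rfl fun j _ => Nat.sub_add_cancel (zeta_le h j)
  rw [sum_zeta (by omega)] at h1
  have h2 : (K ⟨0, by omega⟩ - zeta s ⟨0, by omega⟩) + (K ⟨1, by omega⟩ - zeta s ⟨1, by omega⟩)
      ≤ ∑ j, (K j - zeta s j) :=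
    Finset.add_le_sum (f := fun j => K j - zeta s j) (fun _ _ => Nat.zero_le _)
      (Finset.mem_univ _) (Finset.mem_univ _) (by simp)
  have h3 := heq ⟨0, by omega⟩
  have h4 := heq ⟨1, by omega⟩
  have h5 := zeta_le h ⟨0, by omega⟩
  have h6 := zeta_le h ⟨1, by omega⟩
  funext i
  have := heq i
  omega

/-! ### Thetas with two paths are directed cycles -/

/-- The directed cycle with `n` vertices. -/
def cycleDigraph (n : ℕ) : Digraph (Fin n) where
  Adj x y := y.val = (x.val + 1) % n

/-- The position of a vertex of a generalized theta digraph with two paths on its unique cycle. -/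
def cyclePosition (a b : ℕ) :
    Bool ⊕ (Σ i : Fin 1 ⊕ Fin 1,
      Fin (Sum.elim (fun _ : Fin 1 => a) (fun _ : Fin 1 => b) i - 1)) → ℕ
  | Sum.inl false => 0
  | Sum.inl true => a
  | Sum.inr ⟨Sum.inl _, j⟩ => j.val + 1
  | Sum.inr ⟨Sum.inr _, j⟩ => a + j.val + 1

theorem isIsomorphic_cycleDigraph {a b : ℕ} (ha : 1 ≤ a) (hb : 1 ≤ b) :
    IsIsomorphic (theta (fun _ : Fin 1 => a) (fun _ : Fin 1 => b)) (cycleDigraph (a + b)) := by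
  have hlt : ∀ v, cyclePosition a b v < a + b := by
    rintro ((_ | _) | ⟨i | i, j⟩)
    · simp only [cyclePosition]; omega
    · simp only [cyclePosition]; omega
    · have := j.2
      simp only [Sum.elim_inl] at this
      simp only [cyclePosition]; omega
    · have := j.2
      simp only [Sum.elim_inr] at this
      simp only [cyclePosition]; omega
  have hinj : Function.Injective (cyclePosition a b) := by
    rintro ((_ | _) | ⟨i | i, j⟩) ((_ | _) | ⟨i' | i', j'⟩) h <;>
      simp only [cyclePosition] at h
    all_goals first
      | rfl
      | omega
      | (have := j.2; simp only [Sum.elim_inl, Sum.elim_inr] at this; omega)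
      | (have := j'.2; simp only [Sum.elim_inl, Sum.elim_inr] at this; omega)
      | (have := j.2; have := j'.2; simp only [Sum.elim_inl, Sum.elim_inr] at *; omega)
      | (obtain rfl := Subsingleton.elim i i'
         obtain rfl : j = j' := Fin.ext (by omega)
         rfl)
  have hpos : ∀ (i : Fin 1 ⊕ Fin 1) (j : ℕ),
      j ≤ Sum.elim (fun _ : Fin 1 => a) (fun _ : Fin 1 => b) i →
      cyclePosition a b (pathVertex
        (Sum.elim (fun _ : Fin 1 => false) (fun _ : Fin 1 => true))
        (Sum.elim (fun _ : Fin 1 => true) (fun _ : Fin 1 => false))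
        (Sum.elim (fun _ : Fin 1 => a) (fun _ : Fin 1 => b)) i j) =
      (Sum.elim (fun _ : Fin 1 => 0) (fun _ : Fin 1 => a) i + j) % (a + b) := by
    rintro (i | i) j hj <;> simp only [Sum.elim_inl, Sum.elim_inr] at hj ⊢
    · rcases j with - | j
      · simp [pathVertex_zero, cyclePosition]
      · rw [Nat.mod_eq_of_lt (by omega)]
        rcases hj.lt_or_eq with hj | hj
        · rw [pathVertex_internal _ _ _ _ _ (by simp only [Sum.elim_inl]; omega)]
          simp [cyclePosition]
        · rw [pathVertex_last _ _ _ _ _ (by simp [hj])]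
          simp [cyclePosition, hj]
    · rcases j with - | j
      · rw [Nat.mod_eq_of_lt (by omega)]
        simp [pathVertex_zero, cyclePosition]
      · rcases hj.lt_or_eq with hj | hj
        · rw [Nat.mod_eq_of_lt (by omega),
            pathVertex_internal _ _ _ _ _ (by simp only [Sum.elim_inr]; omega)]
          simp [cyclePosition, add_assoc]
        · rw [pathVertex_last _ _ _ _ _ (by simp [hj])]
          simp [cyclePosition, hj]
  have hadj : ∀ x y, (theta (fun _ : Fin 1 => a) (fun _ : Fin 1 => b)).Adj x y ↔
      cyclePosition a b y = (cyclePosition a b x + 1) % (a + b) := by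
    have hstep : ∀ x y, (theta (fun _ : Fin 1 => a) (fun _ : Fin 1 => b)).Adj x y →
        cyclePosition a b y = (cyclePosition a b x + 1) % (a + b) := by
      rintro x y ⟨i, j, hj, rfl, rfl⟩
      rw [hpos i j hj.le, hpos i (j + 1) hj, Nat.mod_add_mod, add_assoc]
    -- Conversely, `x` has some out-neighbour, at the position following that of `x`; injectivity of
    -- positions identifies it with `y`.
    refine fun x y => ⟨hstep x y, fun h => ?_⟩
    obtain ⟨y', hy'⟩ : ∃ y', (theta (fun _ : Fin 1 => a) (fun _ : Fin 1 => b)).Adj x y' := by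
      rcases x with (_ | _) | ⟨i, j⟩
      · exact ⟨_, Sum.inl 0, 0, ha, by simp [pathVertex_zero], rfl⟩
      · exact ⟨_, Sum.inr 0, 0, hb, by simp [pathVertex_zero], rfl⟩
      · exact ⟨_, (pathUnion_adj_inr _ _ _ i j _).2 rfl⟩
    rwa [hinj (h.trans (hstep x y' hy').symm)]
  have hbij : Function.Bijective fun v => (⟨cyclePosition a b v, hlt v⟩ : Fin (a + b)) := by
    rw [Fintype.bijective_iff_injective_and_card]
    refine ⟨fun v w h => hinj (Fin.mk.inj h), ?_⟩
    simp
    omega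
  exact ⟨⟨Equiv.ofBijective _ hbij, fun {x y} => (hadj x y).symm⟩⟩

theorem IsIsomorphic.symm {V W : Type*} {G : Digraph V} {H : Digraph W} (h : IsIsomorphic G H) :
    IsIsomorphic H G :=
  h.map RelIso.symm

theorem IsIsomorphic.trans {U V W : Type*} {F : Digraph U} {G : Digraph V} {H : Digraph W}
    (h : IsIsomorphic F G) (h' : IsIsomorphic G H) : IsIsomorphic F H :=
  h.elim fun e => h'.map fun e' => RelIso.trans e e'

theorem theta_isIsomorphic_theta_of_add_eq {K₁ K₂ L₁ L₂ : Fin 1 → ℕ} (h₁ : 1 ≤ K₁ 0)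
    (h₂ : 1 ≤ K₂ 0) (h₃ : 1 ≤ L₁ 0) (h₄ : 1 ≤ L₂ 0) (h : K₁ 0 + K₂ 0 = L₁ 0 + L₂ 0) :
    IsIsomorphic (theta K₁ K₂) (theta L₁ L₂) := by
  have hconst : ∀ K : Fin 1 → ℕ, K = fun _ => K 0 := fun K =>
    funext fun i => congrArg K (Subsingleton.elim i 0)
  rw [hconst K₁, hconst K₂, hconst L₁, hconst L₂]
  have := isIsomorphic_cycleDigraph h₁ h₂
  rw [h] at this
  exact this.trans (isIsomorphic_cycleDigraph h₃ h₄).symm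

theorem IsIsomorphic.refl {V : Type*} (G : Digraph V) : IsIsomorphic G G :=
  ⟨RelIso.refl _⟩

/-! ### Maximality of the rose -/

theorem div_one_sub_nonneg {α : ℝ} (h0 : 0 ≤ α) (h1 : α < 1) : 0 ≤ α / (1 - α) :=
  div_nonneg h0 (by linarith)

/-- The left side of the rose equation is nondecreasing in `t`, so exceeding 1 at `t` puts the root
strictly below `t`. -/
theorem alphaSpectralRadius_lt_rose {m k : ℕ} (hk : 1 ≤ k) (hm : 2 * k ≤ m) {α t : ℝ}
    (h0 : 0 ≤ α) (h1 : α < 1) (ht : 0 < t)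
    (h : 1 < ∑ i, t ^ gammaOne m k i + α / (1 - α) * ((k : ℝ) - 1) * t) :
    ENNReal.ofReal (α + (1 - α) / t) < alphaSpectralRadius α (rose (gammaOne m k)) := by
  have hp := isRosePartition_gammaOne hk hm
  have hc := div_one_sub_nonneg h0 h1
  have hk' : (1 : ℝ) ≤ k := by exact_mod_cast hk
  obtain ⟨u, hu, -, hroot⟩ := exists_rose_root _ hp.2.1 hk hc
  rw [alphaSpectralRadius_rose _ hp.2.1 h0 h1 hu hroot, ← not_le,
    ofReal_add_div_le_iff h0 h1 hu ht, not_le]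
  by_contra! hcon
  have hs : ∑ i, t ^ gammaOne m k i ≤ ∑ i, u ^ gammaOne m k i :=
    Finset.sum_le_sum fun i _ => pow_le_pow_left₀ ht.le hcon _
  have hl : α / (1 - α) * ((k : ℝ) - 1) * t ≤ α / (1 - α) * ((k : ℝ) - 1) * u :=
    mul_le_mul_of_nonneg_left hcon (mul_nonneg hc (by linarith))
  linarith

theorem alphaSpectralRadius_rose_lt_rose_gammaOne {m k : ℕ} (hk : 2 ≤ k) (hm : 2 * k ≤ m)
    {p : Fin k → ℕ} (hp : IsRosePartition m k p) (hne : p ≠ gammaOne m k) {α : ℝ}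
    (h0 : 0 ≤ α) (h1 : α < 1) :
    alphaSpectralRadius α (rose p) < alphaSpectralRadius α (rose (gammaOne m k)) := by
  have hc := div_one_sub_nonneg h0 h1
  have hk' : (2 : ℝ) ≤ k := by exact_mod_cast hk
  obtain ⟨t, ht, ht1, hroot⟩ := exists_rose_root _ hp.2.1 (by omega) hc
  rw [alphaSpectralRadius_rose _ hp.2.1 h0 h1 ht hroot]
  refine alphaSpectralRadius_lt_rose (by omega) hm h0 h1 ht ?_
  have ht1' : t < 1 := by
    refine ht1.lt_of_ne ?_
    rintro rfl
    simp only [one_pow, Finset.sum_const, Finset.card_univ, Fintype.card_fin, nsmul_eq_mul]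
      at hroot
    have : 0 ≤ α / (1 - α) * ((k : ℝ) - 1) := mul_nonneg hc (by linarith)
    linarith
  have := sum_pow_lt_sum_pow_gammaOne (by omega) hp hne ht ht1'
  linarith

theorem alphaSpectralRadius_theta_lt_rose_gammaOne {m m₁ m₂ s r : ℕ} (hs : 1 ≤ s) (hr : 1 ≤ r)
    (hm : 2 * (s + r) ≤ m) {K₁ : Fin s → ℕ} {K₂ : Fin r → ℕ}
    (hK₁ : IsThetaPartition m₁ s K₁) (hK₂ : IsThetaPartition m₂ r K₂) {α : ℝ}
    (h0 : 0 ≤ α) (h1 : α < 1) :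
    alphaSpectralRadius α (theta K₁ K₂) <
      alphaSpectralRadius α (rose (gammaOne m (s + r))) := by
  have hc := div_one_sub_nonneg h0 h1
  have hs' : (1 : ℝ) ≤ s := by exact_mod_cast hs
  have hr' : (1 : ℝ) ≤ r := by exact_mod_cast hr
  obtain ⟨t, ht, ht1, hA, -, hroot⟩ := exists_theta_root K₁ K₂ hs hr hK₁.2.1 hc
  rw [alphaSpectralRadius_theta K₁ K₂ hs hK₁.2.1 hK₂.2.1 hK₁.eq_of_eq_one hK₂.eq_of_eq_one h0 h1
    ht hA hroot]
  refine alphaSpectralRadius_lt_rose (by omega) hm h0 h1 ht ?_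
  have hX := sum_pow_le_of_isThetaPartition hs hK₁ ht.le ht1
  have hY := sum_pow_le_of_isThetaPartition hr hK₂ ht.le ht1
  have hY0 : 0 ≤ ∑ i, t ^ K₂ i := Finset.sum_nonneg fun i _ => (pow_pos ht _).le
  have hσ : (0 : ℝ) ≤ s - 1 := by linarith
  have hineq := theta_root_inequality hc ht ht1 hσ (sub_nonneg.2 hr')
    (hroot.trans_le (mul_le_mul hX hY hY0 (by positivity)))
  obtain ⟨n, hn⟩ := Nat.exists_eq_add_of_le' (show 1 ≤ s + r by omega)
  have hn' : (s : ℝ) + r = n + 1 := by exact_mod_cast hn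
  rw [hn, sum_pow_gammaOne]
  push_cast
  rw [show (s : ℝ) - 1 + (r - 1) + 1 = n by linarith] at hineq
  have : 0 < t ^ (m - 2 * (n + 1) + 2) := pow_pos ht _
  rw [add_sub_cancel_right]
  linarith

/-! ### Minimality of the theta digraph of `zeta` -/

theorem alphaSpectralRadius_theta_one {m₁ m₂ s : ℕ} (hs : 1 ≤ s) {K₁ : Fin s → ℕ}
    {K₂ : Fin 1 → ℕ} (hK₁ : IsThetaPartition m₁ s K₁) (hK₂ : IsThetaPartition m₂ 1 K₂) {α : ℝ}
    (h0 : 0 ≤ α) (h1 : α < 1) :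
    ∃ t : ℝ, 0 < t ∧ t ≤ 1 ∧
      ∑ i, t ^ (K₁ i + K₂ 0) + α / (1 - α) * ((s : ℝ) - 1) * t = 1 ∧
      alphaSpectralRadius α (theta K₁ K₂) = ENNReal.ofReal (α + (1 - α) / t) := by
  obtain ⟨t, ht, ht1, hA, -, hroot⟩ :=
    exists_theta_root K₁ K₂ hs le_rfl hK₁.2.1 (div_one_sub_nonneg h0 h1)
  refine ⟨t, ht, ht1, ?_, alphaSpectralRadius_theta K₁ K₂ hs hK₁.2.1 hK₂.2.1 hK₁.eq_of_eq_one
    hK₂.eq_of_eq_one h0 h1 ht hA hroot⟩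
  simp only [Finset.univ_unique, Finset.sum_singleton, Fin.default_eq_zero] at hroot
  simp only [pow_add, ← Finset.sum_mul]
  push_cast at hroot
  linarith

theorem isThetaPartition_one {n : ℕ} (hn : 1 ≤ n) : IsThetaPartition n 1 (fun _ => n) :=
  ⟨fun _ _ _ => le_rfl, fun _ => hn, fun i hi => absurd hi (by have := i.2; omega), by simp⟩

/-- Packages the root `u` with the monotonicity of its equation, so that later comparisons only need
the left side evaluated at another digraph's root. -/
theorem exists_root_thetaOne_zeta {m s : ℕ} (hs : 1 ≤ s) (hm : 2 * s ≤ m) {α : ℝ}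
    (h0 : 0 ≤ α) (h1 : α < 1) :
    ∃ u : ℝ, 0 < u ∧
      alphaSpectralRadius α (thetaOne m (zeta s)) = ENNReal.ofReal (α + (1 - α) / u) ∧
      (∀ t, 0 < t →
        ∑ i, t ^ (zeta s i + (m - (2 * s - 1))) + α / (1 - α) * ((s : ℝ) - 1) * t ≤ 1 →
          t ≤ u) ∧
      (∀ t, 0 < t →
        ∑ i, t ^ (zeta s i + (m - (2 * s - 1))) + α / (1 - α) * ((s : ℝ) - 1) * t < 1 →
          t < u) := by
  have hc := div_one_sub_nonneg h0 h1
  have hs' : (1 : ℝ) ≤ s := by exact_mod_cast hs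
  obtain ⟨u, hu, -, hroot, hrad⟩ := alphaSpectralRadius_theta_one hs (isThetaPartition_zeta hs)
    (isThetaPartition_one (n := m - ∑ j, zeta s j) (by rw [sum_zeta hs]; omega)) h0 h1
  simp only [sum_zeta hs] at hroot
  refine ⟨u, hu, hrad, fun t ht h => ?_, fun t ht h => ?_⟩
  · by_contra! hcon
    have hlt : ∑ i, u ^ (zeta s i + (m - (2 * s - 1))) <
        ∑ i, t ^ (zeta s i + (m - (2 * s - 1))) :=
      Finset.sum_lt_sum_of_nonempty ⟨⟨0, hs⟩, Finset.mem_univ _⟩ fun i _ =>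
        pow_lt_pow_left₀ hcon hu.le (by omega)
    have hl : α / (1 - α) * ((s : ℝ) - 1) * u ≤ α / (1 - α) * ((s : ℝ) - 1) * t :=
      mul_le_mul_of_nonneg_left hcon.le (mul_nonneg hc (by linarith))
    linarith
  · by_contra! hcon
    have hle : ∑ i, u ^ (zeta s i + (m - (2 * s - 1))) ≤
        ∑ i, t ^ (zeta s i + (m - (2 * s - 1))) :=
      Finset.sum_le_sum fun i _ => pow_le_pow_left₀ hu.le hcon _
    have hl : α / (1 - α) * ((s : ℝ) - 1) * u ≤ α / (1 - α) * ((s : ℝ) - 1) * t :=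
      mul_le_mul_of_nonneg_left hcon (mul_nonneg hc (by linarith))
    linarith

/-- Each rose cycle is shorter than every cycle of the theta digraph, and the rose equation has the
further positive term `t ^ p (Fin.last s)`. -/
theorem alphaSpectralRadius_thetaOne_zeta_lt_rose {m s : ℕ} (hs : 1 ≤ s) (hm : 2 * s ≤ m)
    {p : Fin (s + 1) → ℕ} (hp : IsRosePartition m (s + 1) p) {α : ℝ} (h0 : 0 ≤ α) (h1 : α < 1) :
    alphaSpectralRadius α (thetaOne m (zeta s)) < alphaSpectralRadius α (rose p) := by
  have hc := div_one_sub_nonneg h0 h1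
  obtain ⟨u, hu, hrad, -, hlt⟩ := exists_root_thetaOne_zeta hs hm h0 h1
  obtain ⟨t, ht, ht1, hroot⟩ := exists_rose_root _ hp.2.1 (by omega) hc
  rw [alphaSpectralRadius_rose _ hp.2.1 h0 h1 ht hroot, hrad, ← not_le,
    ofReal_add_div_le_iff h0 h1 ht hu, not_le]
  refine hlt t ht ?_
  have hple : ∀ i, p i ≤ m - 2 * s := fun i => by
    have h := hp.2.2
    rw [Fin.sum_univ_succAbove _ i] at h
    have h2 : ∑ _j : Fin s, 2 ≤ ∑ j, p (i.succAbove j) :=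
      Finset.sum_le_sum fun j _ => hp.2.1 _
    simp only [Finset.sum_const, Finset.card_univ, Fintype.card_fin, smul_eq_mul] at h2
    omega
  have hle : ∑ i, t ^ (zeta s i + (m - (2 * s - 1))) ≤ ∑ i : Fin s, t ^ p i.castSucc :=
    Finset.sum_le_sum fun i _ => pow_le_pow_of_le_one ht.le ht1 (by
      have := hple i.castSucc
      omega)
  rw [Fin.sum_univ_castSucc] at hroot
  push_cast at hroot
  have : 0 < t ^ p (Fin.last s) := pow_pos ht _
  have : 0 ≤ α / (1 - α) * t := mul_nonneg hc ht.le
  linarith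

theorem alphaSpectralRadius_thetaOne_zeta_le {m m₁ m₂ s : ℕ} (hs : 1 ≤ s) (hm : 2 * s ≤ m)
    (hadd : m₁ + m₂ = m) {K₁ : Fin s → ℕ} {K₂ : Fin 1 → ℕ} (hK₁ : IsThetaPartition m₁ s K₁)
    (hK₂ : IsThetaPartition m₂ 1 K₂) {α : ℝ} (h0 : 0 ≤ α) (h1 : α < 1) :
    alphaSpectralRadius α (thetaOne m (zeta s)) ≤ alphaSpectralRadius α (theta K₁ K₂) ∧
      (alphaSpectralRadius α (theta K₁ K₂) = alphaSpectralRadius α (thetaOne m (zeta s)) →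
        IsIsomorphic (theta K₁ K₂) (thetaOne m (zeta s))) := by
  have hc := div_one_sub_nonneg h0 h1
  have hs' : (1 : ℝ) ≤ s := by exact_mod_cast hs
  have hK₂0 : K₂ 0 = m₂ := by simpa using hK₂.2.2.2
  obtain ⟨u, hu, hrad, hle, hlt⟩ := exists_root_thetaOne_zeta hs hm h0 h1
  obtain ⟨t, ht, ht1, hroot, hrad'⟩ := alphaSpectralRadius_theta_one hs hK₁ hK₂ h0 h1
  have hexp : ∀ i, K₁ i + K₂ 0 ≤ zeta s i + (m - (2 * s - 1)) := fun i => by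
    rw [hK₂0]
    exact add_le_zeta_add hs hadd hK₁ i
  have hterm : ∀ i ∈ Finset.univ, t ^ (zeta s i + (m - (2 * s - 1))) ≤ t ^ (K₁ i + K₂ 0) :=
    fun i _ => pow_le_pow_of_le_one ht.le ht1 (hexp i)
  have hsum := Finset.sum_le_sum hterm
  rw [hrad, hrad']
  refine ⟨(ofReal_add_div_le_iff h0 h1 hu ht).2 (hle t ht (by linarith)), fun heq => ?_⟩
  have hut : u ≤ t := (ofReal_add_div_le_iff h0 h1 ht hu).1 heq.le
  -- For `2 ≤ s` the root is below 1, so equal radii force equal exponents. For `s = 1` both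
  -- digraphs are directed cycles of length `m`.
  rcases hs.lt_or_eq with hs2 | rfl
  · have hs2' : (2 : ℝ) ≤ s := by exact_mod_cast hs2
    have ht1' : t < 1 := by
      refine ht1.lt_of_ne ?_
      rintro rfl
      simp only [one_pow, Finset.sum_const, Finset.card_univ, Fintype.card_fin, nsmul_eq_mul]
        at hroot
      have : 0 ≤ α / (1 - α) * ((s : ℝ) - 1) := mul_nonneg hc (by linarith)
      linarith
    have hall : ∀ i, K₁ i + K₂ 0 = zeta s i + (m - (2 * s - 1)) := by
      by_contra! hcon
      obtain ⟨i, hi⟩ := hcon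
      have hstrict := Finset.sum_lt_sum hterm ⟨i, Finset.mem_univ i,
        pow_lt_pow_right_of_lt_one₀ ht ht1' ((hexp i).lt_of_ne hi)⟩
      exact (hlt t ht (by linarith)).not_ge hut
    have hKz : K₁ = zeta s := eq_zeta_of_add_eq hs2 hadd hK₁ (by simpa only [hK₂0] using hall)
    subst hKz
    have hK₂e : K₂ = fun _ => m - ∑ j, zeta s j := by
      funext i
      rw [Subsingleton.elim i 0, hK₂0, hK₁.2.2.2]
      omega
    subst hK₂e
    exact IsIsomorphic.refl _
  · have hK₁0 : K₁ 0 = m₁ := by simpa using hK₁.2.2.2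
    have hz : ∑ j, zeta 1 j = 1 := sum_zeta le_rfl
    have hz0 : zeta 1 0 = 1 := rfl
    refine theta_isIsomorphic_theta_of_add_eq (hK₁.2.1 0) (hK₂.2.1 0) hz0.ge ?_ ?_
    · rw [hz]
      omega
    · rw [hz, hz0, hK₁0, hK₂0]
      omega

end AlphaSpectral

open AlphaSpectral

theorem mainTheorem6 (α : ℝ) (hα₀ : 0 ≤ α) (hα₁ : α < 1) (k m : ℕ) (hk : 2 ≤ k) :
    (2 * k ≤ m →
      AlphaSpectral.InRose m k (AlphaSpectral.rose (AlphaSpectral.gammaOne m k)) ∧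
      ∀ (V : Type*) [Fintype V] (G : Digraph V),
        (AlphaSpectral.InRose m k G ∨ AlphaSpectral.InTheta m k G) →
        AlphaSpectral.alphaSpectralRadius α G ≤
            AlphaSpectral.alphaSpectralRadius α
              (AlphaSpectral.rose (AlphaSpectral.gammaOne m k)) ∧
          (AlphaSpectral.alphaSpectralRadius α G =
              AlphaSpectral.alphaSpectralRadius α
                (AlphaSpectral.rose (AlphaSpectral.gammaOne m k)) →
            AlphaSpectral.IsIsomorphic G
              (AlphaSpectral.rose (AlphaSpectral.gammaOne m k)))) ∧
    (2 * k ≤ m + 2 →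
      AlphaSpectral.InThetaOne m k
        (AlphaSpectral.thetaOne m (AlphaSpectral.zeta (k - 1))) ∧
      ∀ (V : Type*) [Fintype V] (G : Digraph V),
        (AlphaSpectral.InRose m k G ∨ AlphaSpectral.InThetaOne m k G) →
        AlphaSpectral.alphaSpectralRadius α
              (AlphaSpectral.thetaOne m (AlphaSpectral.zeta (k - 1))) ≤
            AlphaSpectral.alphaSpectralRadius α G ∧
          (AlphaSpectral.alphaSpectralRadius α G =
              AlphaSpectral.alphaSpectralRadius α
                (AlphaSpectral.thetaOne m (AlphaSpectral.zeta (k - 1))) →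
            AlphaSpectral.IsIsomorphic G
              (AlphaSpectral.thetaOne m (AlphaSpectral.zeta (k - 1))))) := by
  refine ⟨fun hm => ⟨⟨_, isRosePartition_gammaOne (by omega) hm, IsIsomorphic.refl _⟩, ?_⟩,
    fun hm => ?_⟩
  · intro V _ G hG
    by_cases hiso : IsIsomorphic G (rose (gammaOne m k))
    · exact ⟨(alphaSpectralRadius_eq_of_isIsomorphic α hiso).le, fun _ => hiso⟩
    · suffices h : alphaSpectralRadius α G < alphaSpectralRadius α (rose (gammaOne m k)) from
        ⟨h.le, fun he => absurd he h.ne⟩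
      rcases hG with ⟨p, hp, he⟩ | ⟨s, r, hs, hr, rfl, m₁, m₂, hadd, K₁, K₂, hK₁, hK₂, he⟩
      · rw [alphaSpectralRadius_eq_of_isIsomorphic α he]
        refine alphaSpectralRadius_rose_lt_rose_gammaOne hk hm hp ?_ hα₀ hα₁
        rintro rfl
        exact hiso he
      · rw [alphaSpectralRadius_eq_of_isIsomorphic α he]
        exact alphaSpectralRadius_theta_lt_rose_gammaOne hs hr hm hK₁ hK₂ hα₀ hα₁
  · obtain ⟨s, rfl⟩ := Nat.exists_eq_add_of_le' (show 1 ≤ k by omega)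
    have hs : 1 ≤ s := by omega
    have hm' : 2 * s ≤ m := by omega
    rw [Nat.add_sub_cancel]
    refine ⟨⟨2 * s - 1, m - ∑ j, zeta s j, ?_, zeta s, _, isThetaPartition_zeta hs,
      isThetaPartition_one ?_, IsIsomorphic.refl _⟩, ?_⟩
    · rw [sum_zeta hs]
      omega
    · rw [sum_zeta hs]
      omega
    · intro V _ G hG
      rcases hG with ⟨p, hp, he⟩ | ⟨m₁, m₂, hadd, K₁, K₂, hK₁, hK₂, he⟩
      · rw [alphaSpectralRadius_eq_of_isIsomorphic α he]
        have h := alphaSpectralRadius_thetaOne_zeta_lt_rose hs hm' hp hα₀ hα₁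
        exact ⟨h.le, fun he => absurd he h.ne'⟩
      · rw [alphaSpectralRadius_eq_of_isIsomorphic α he]
        have h := alphaSpectralRadius_thetaOne_zeta_le hs hm' hadd hK₁ hK₂ hα₀ hα₁
        exact ⟨h.1, fun hr => he.trans (h.2 hr)⟩
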